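/- Let $G$ be a finite group, and let $F(G)$ denote its Fitting subgroup, i.e. its largest normal nilpotent subgroup. Let $A$ and $B$ be supersoluble subgroups of $G$ with $G=\langle A,B\rangle$, such that $A$ is subnormal in $\langle A,F(G)\rangle$ and $B$ is subnormal in $\langle B,F(G)\rangle$ (that is, $A$ and $B$ are $F(G)$-subnormal). If the commutator subgroup $[A,B]=\langle [a,b] : a\in A,\ b\in B\rangle$ is nilpotent, then $G$ is supersoluble. -/

import Mathlib

/-- A group `G` is supersoluble if it has a finite series
`⊥ = H 0 ≤ H 1 ≤ ⋯ ≤ H n = ⊤` of subgroups, each of them normal in the whole group `G`,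
such that every factor `H (i + 1) / H i` is cyclic. The factor is written as the image
of `H (i + 1)` in `G ⧸ H i`. -/
def IsSupersoluble (G : Type*) [Group G] : Prop :=
  ∃ (n : ℕ) (H : ℕ → Subgroup G) (_ : ∀ i, (H i).Normal),
    H 0 = ⊥ ∧ H n = ⊤ ∧ Monotone H ∧
      ∀ i < n, IsCyclic ((H (i + 1)).map (QuotientGroup.mk' (H i)))

/-- The Fitting subgroup `F(G)`: the subgroup generated by all normal nilpotent subgroups
of `G`. For a finite group it is the largest normal nilpotent subgroup. -/
def fittingSubgroup (G : Type*) [Group G] : Subgroup G :=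
  sSup {N : Subgroup G | N.Normal ∧ Group.IsNilpotent N}

/-- `H` is `R`-subnormal if `H` is a subnormal subgroup of `⟨H, R⟩`. -/
def Subgroup.IsRelSubnormal {G : Type*} [Group G] (R H : Subgroup G) : Prop :=
  (H.subgroupOf (H ⊔ R)).IsSubnormal

/-! Since `A` and `B` generate `G`, the nilpotent group `[A, B]` is normal, so it lies in `F =
F(G)`. Modulo `F`, `A` and `B` commute; hence `AF` and `BF` are normal, and `A`, `B` are subnormal
in `G`. Supersolubility makes `A'` and `B'` nilpotent, and subnormality puts them in `F`. So `G' ≤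
F` is nilpotent.

Now induct on `|G|` (`IsSupersoluble.of_sup_eq_top`). Take a nontrivial abelian normal `V`
centralized by `G'`. Some nontrivial `⟨u⟩ ≤ V` is normalized by `A`. The elements of `V` on which
`A` acts with the same exponents as on `u` form a subgroup `W`, normal because `G` acts on `V`
through the abelian group `G/G'`. Some nontrivial `⟨v⟩ ≤ W` is normalized by `B`, and by `A` as
well, so it is normal in `G`; pass to `G/⟨v⟩`. -/

open Subgroup
open scoped commutatorElement

/-! ### Fitting's theorem -/

namespace Subgroup

variable {G : Type*} [Group G]

theorem isNilpotent_map {G' : Type*} [Group G'] (f : G →* G') {M : Subgroup G}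
    (hM : Group.IsNilpotent M) : Group.IsNilpotent (M.map f) := by
  rw [isNilpotent_iff_lowerCentralSeries] at hM ⊢
  obtain ⟨n, hn⟩ := hM
  exact ⟨n, by rw [← map_lowerCentralSeries, hn, Subgroup.map_bot]⟩

theorem isNilpotent_subgroupOf {M : Subgroup G} (K : Subgroup G) (hM : Group.IsNilpotent M)
    (h : M ≤ K) : Group.IsNilpotent (M.subgroupOf K) :=
  (Group.isNilpotent_congr (subgroupOfEquivOfLe h)).mpr hM

theorem isNilpotent_of_le {M N : Subgroup G} (hN : Group.IsNilpotent N) (h : M ≤ N) :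
    Group.IsNilpotent M :=
  (Group.isNilpotent_congr (subgroupOfEquivOfLe h)).mp inferInstance

/-- A nontrivial normal subgroup contained in a nilpotent subgroup `M` meets the
centralizer of `M`. -/
theorem inf_centralizer_ne_bot {M W : Subgroup G} (hM : Group.IsNilpotent M) [W.Normal]
    (hWM : W ≤ M) (hW : W ≠ ⊥) : W ⊓ centralizer M ≠ ⊥ := by
  classical
  rw [isNilpotent_iff_lowerCentralSeries] at hM
  obtain ⟨n, hn⟩ := hM
  -- The last nontrivial intersection of `W` with the lower central series of `M` is centralized by
  -- `M`.
  have hex : ∃ k, W ⊓ M.lowerCentralSeries k = ⊥ := ⟨n, by rw [hn, inf_bot_eq]⟩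
  have hk := Nat.find_spec hex
  obtain ⟨k, hk'⟩ : ∃ k, Nat.find hex = k + 1 := by
    refine Nat.exists_eq_succ_of_ne_zero fun h0 => hW ?_
    rw [h0, lowerCentralSeries_zero, inf_eq_left.mpr hWM] at hk
    exact hk
  have hne : W ⊓ M.lowerCentralSeries k ≠ ⊥ := Nat.find_min hex (by omega)
  rw [hk'] at hk
  refine ne_bot_of_le_ne_bot hne (le_inf inf_le_left ?_)
  rw [← commutator_eq_bot_iff_le_centralizer, eq_bot_iff, ← hk]
  refine le_inf ((commutator_mono inf_le_left le_rfl).trans (commutator_le_left _ _)) ?_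
  rw [lowerCentralSeries_succ]
  exact commutator_mono inf_le_right le_rfl

/-- It suffices to find a nontrivial center and induct on the quotient. If `M ∩ C(N) = 1`, then `M ∩
N = 1`, so `M` centralizes `N` and `M = 1`. Otherwise `M ∩ C(N)` meets `C(M)`, and that intersection
is central. -/
theorem isNilpotent_of_sup_eq_top [Finite G] (M N : Subgroup G) [M.Normal] [N.Normal]
    (hM : Group.IsNilpotent M) (hN : Group.IsNilpotent N) (h : M ⊔ N = ⊤) :
    Group.IsNilpotent G := by
  induction hn : Nat.card G using Nat.strong_induction_on generalizing G with
  | _ n ih =>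
  rcases subsingleton_or_nontrivial G with hG | hG
  · exact Group.isNilpotent_of_subsingleton
  have key : ∀ {W : Subgroup G}, W ≤ centralizer M → W ≤ centralizer N → W ≤ center G := by
    intro W h1 h2
    rw [← centralizer_univ, ← coe_top, ← h, le_centralizer_iff]
    exact sup_le (le_centralizer_iff.mp h1) (le_centralizer_iff.mp h2)
  have hZ : center G ≠ ⊥ := by
    by_cases hMN : M ⊓ centralizer N = ⊥
    · by_cases hM0 : M = ⊥
      · rw [hM0, bot_sup_eq] at h
        subst h
        rw [Group.isNilpotent_top] at hN
        exact Group.IsNilpotent.center_ne_bot G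
      · have h1 : M ⊓ N = ⊥ := by
          by_contra hne
          refine inf_centralizer_ne_bot hN (W := M ⊓ N) inf_le_right hne ?_
          exact eq_bot_mono (inf_le_inf_right _ inf_le_left) hMN
        have h2 : ⁅M, N⁆ = ⊥ := commutator_eq_bot_of_disjoint (disjoint_iff.mpr h1)
        have := commutator_eq_bot_iff_le_centralizer.mp h2
        exact absurd (by rwa [inf_eq_left.mpr this] at hMN) hM0
    · have := inf_centralizer_ne_bot hM (W := M ⊓ centralizer N) inf_le_left hMN
      exact ne_bot_of_le_ne_bot this (key inf_le_right (inf_le_left.trans inf_le_right))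
  refine Group.of_quotient_center_nilpotent ?_
  have hsurj := QuotientGroup.mk'_surjective (center G)
  have : (M.map (QuotientGroup.mk' (center G))).Normal := Normal.map ‹_› _ hsurj
  have : (N.map (QuotientGroup.mk' (center G))).Normal := Normal.map ‹_› _ hsurj
  refine ih _ ?_ (M.map (QuotientGroup.mk' (center G))) (N.map (QuotientGroup.mk' (center G)))
    (isNilpotent_map _ hM) (isNilpotent_map _ hN) ?_ rfl
  · rw [← hn, card_eq_card_quotient_mul_card_subgroup (center G)]
    exact lt_mul_of_one_lt_right Nat.card_pos ((one_lt_card_iff_ne_bot _).mpr hZ)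
  · rw [← map_sup, h, map_top_of_surjective _ hsurj]

/-- Fitting's theorem for mutually normalizing subgroups. -/
theorem isNilpotent_sup [Finite G] {M N : Subgroup G} (hM : Group.IsNilpotent M)
    (hN : Group.IsNilpotent N) (hMN : M ≤ normalizer N) (hNM : N ≤ normalizer M) :
    Group.IsNilpotent (M ⊔ N : Subgroup G) := by
  have : (M.subgroupOf (M ⊔ N)).Normal :=
    normal_subgroupOf_of_le_normalizer (sup_le le_normalizer hNM)
  have : (N.subgroupOf (M ⊔ N)).Normal :=
    normal_subgroupOf_of_le_normalizer (sup_le hMN le_normalizer)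
  refine isNilpotent_of_sup_eq_top (M.subgroupOf (M ⊔ N)) (N.subgroupOf (M ⊔ N))
    (isNilpotent_subgroupOf _ hM le_sup_left) (isNilpotent_subgroupOf _ hN le_sup_right) ?_
  rw [← subgroupOf_sup le_sup_left le_sup_right, subgroupOf_self]

/-- A subgroup `H` of a finite group has a greatest nilpotent normal subgroup. -/
theorem exists_isGreatest_isNilpotent [Finite G] (H : Subgroup G) :
    ∃ M, IsGreatest {M : Subgroup G | M ≤ H ∧ H ≤ normalizer M ∧ Group.IsNilpotent M} M := by
  obtain ⟨M, hM⟩ := (Set.toFinite {M : Subgroup G | M ≤ H ∧ H ≤ normalizer M ∧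
    Group.IsNilpotent M}).exists_maximal ⟨⊥, bot_le, le_normalizer_of_normal, inferInstance⟩
  refine ⟨M, hM.prop, fun N hN => ?_⟩
  obtain ⟨h1, h2, h3⟩ := hM.prop
  obtain ⟨k1, k2, k3⟩ := hN
  exact le_sup_right.trans (hM.le_of_ge ⟨sup_le h1 k1,
    (le_inf h2 k2).trans (normalizer_inf_normalizer_le_normalizer_sup M N),
    isNilpotent_sup h3 k3 (h1.trans k2) (k1.trans h2)⟩ le_sup_left)

end Subgroup

/-! ### The Fitting subgroup and subnormality -/

theorem fittingSubgroup_normal (G : Type*) [Group G] : (fittingSubgroup G).Normal :=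
  sSup_normal _ fun _ hN => hN.1

theorem fittingSubgroup_isNilpotent (G : Type*) [Group G] [Finite G] :
    Group.IsNilpotent (fittingSubgroup G) := by
  obtain ⟨M, ⟨-, -, hM⟩, hmax⟩ := exists_isGreatest_isNilpotent (⊤ : Subgroup G)
  refine isNilpotent_of_le hM (sSup_le fun N hN => hmax ⟨le_top, ?_, hN.2⟩)
  rw [top_le_iff, normalizer_eq_top_iff]
  exact hN.1

/-- Climb the subnormal chain: when `H` is normal in `K`, conjugation by `K` preserves the greatest
nilpotent normal subgroup of `H`, so `K` normalizes it. -/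
theorem Subgroup.IsSubnormal.le_fittingSubgroup {G : Type*} [Group G] [Finite G]
    {K : Subgroup G} (hK : K.IsSubnormal) {N : Subgroup G} (hNK : N ≤ K) (hKN : K ≤ normalizer N)
    (hN : Group.IsNilpotent N) : N ≤ fittingSubgroup G := by
  induction hK generalizing N with
  | top => exact le_sSup ⟨normalizer_eq_top_iff.mp (top_le_iff.mp hKN), hN⟩
  | step H K hHK hK hnorm ih =>
    obtain ⟨M, ⟨hM1, hM2, hM3⟩, hmax⟩ := exists_isGreatest_isNilpotent H
    refine (hmax ⟨hNK, hKN, hN⟩).trans (ih (hM1.trans hHK) ?_ hM3)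
    rw [normal_subgroupOf_iff_le_normalizer hHK] at hnorm
    have hconj : ∀ k ∈ K, M.map (MulAut.conj k).toMonoidHom ≤ M := by
      intro k hk
      have hHk : H.map (MulAut.conj k).toMonoidHom = H := mem_normalizer_iff_map_conj_eq.mp (hnorm hk)
      refine hmax ⟨(map_mono hM1).trans hHk.le, ?_, isNilpotent_map _ hM3⟩
      conv_lhs => rw [← hHk]
      exact (map_mono hM2).trans (le_normalizer_map _)
    intro k hk
    rw [mem_normalizer_iff]
    refine fun x => ⟨fun hx => hconj k hk ⟨x, hx, rfl⟩, fun hx => ?_⟩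
    have := hconj k⁻¹ (inv_mem hk) ⟨_, hx, rfl⟩
    simpa [mul_assoc] using this

/-! ### Cyclic normal subgroups and supersoluble groups -/

namespace Subgroup

variable {G : Type*} [Group G]

/-- Every commutator centralizes a normal cyclic subgroup. -/
theorem commutator_le_centralizer_of_isCyclic (C : Subgroup G) [C.Normal] (hC : IsCyclic C) :
    _root_.commutator G ≤ centralizer (C : Set G) := by
  obtain ⟨c, rfl⟩ := (Subgroup.isCyclic_iff_exists_zpowers_eq_top C).mp hC
  have hconj : ∀ g : G, ∃ k : ℤ, MulAut.conj g c = c ^ k := fun g => by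
    obtain ⟨k, hk⟩ := mem_zpowers_iff.mp (Normal.conj_mem ‹_› c (mem_zpowers c) g)
    exact ⟨k, by simp [hk]⟩
  -- Power maps commute.
  have hcomm : ∀ g h : G, MulAut.conj (g * h) c = MulAut.conj (h * g) c := fun g h => by
    obtain ⟨k, hk⟩ := hconj g
    obtain ⟨l, hl⟩ := hconj h
    simp only [map_mul, MulAut.mul_apply, hk, hl, map_zpow, ← zpow_mul, mul_comm k l]
  rw [_root_.commutator_def, commutator_le]
  intro g _ h _
  have h1 : MulAut.conj ⁅g, h⁆ c = c := by
    have h2 : ⁅g, h⁆ = (g * h) * (g⁻¹ * h⁻¹) := by simp [commutatorElement_def, mul_assoc]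
    rw [h2, map_mul, MulAut.mul_apply, hcomm, ← MulAut.mul_apply, ← map_mul]
    simp [mul_assoc]
  rw [mem_centralizer_iff]
  intro x hx
  obtain ⟨k, rfl⟩ := mem_zpowers_iff.mp hx
  have h2 : Commute c ⁅g, h⁆ := (mul_inv_eq_iff_eq_mul.mp h1).symm
  exact h2.zpow_left k

theorem isCyclic_map_mk'_of_le {N K : Subgroup G} [N.Normal] (x : G)
    (h : K ≤ zpowers x ⊔ N) : IsCyclic (K.map (QuotientGroup.mk' N)) := by
  have h1 : K.map (QuotientGroup.mk' N) ≤ zpowers (QuotientGroup.mk' N x) := by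
    refine (map_mono h).trans ?_
    rw [map_sup, MonoidHom.map_zpowers, QuotientGroup.map_mk'_self, sup_bot_eq]
  exact isCyclic_of_le h1

theorem exists_le_zpowers_sup {N K : Subgroup G} [N.Normal]
    (h : IsCyclic (K.map (QuotientGroup.mk' N))) : ∃ x : G, K ≤ zpowers x ⊔ N := by
  obtain ⟨y, hy⟩ := (Subgroup.isCyclic_iff_exists_zpowers_eq_top _).mp h
  obtain ⟨x, rfl⟩ := QuotientGroup.mk'_surjective N y
  refine ⟨x, ?_⟩
  have h1 : K ≤ (zpowers (QuotientGroup.mk' N x)).comap (QuotientGroup.mk' N) := by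
    rw [hy]; exact le_comap_map _ _
  rwa [← MonoidHom.map_zpowers, comap_map_eq, QuotientGroup.ker_mk'] at h1

end Subgroup

namespace IsSupersoluble

variable {G : Type*} [Group G]

theorem of_surjective {Q : Type*} [Group Q] (hG : IsSupersoluble G) (f : G →* Q)
    (hf : Function.Surjective f) : IsSupersoluble Q := by
  obtain ⟨n, H, hN, h0, hn, hmono, hcyc⟩ := hG
  have hN' : ∀ i, ((H i).map f).Normal := fun i => (hN i).map f hf
  refine ⟨n, fun i => (H i).map f, hN', by simp [h0], by simp [hn, map_top_of_surjective f hf],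
    fun i j hij => map_mono (hmono hij), fun i hi => ?_⟩
  obtain ⟨x, hx⟩ := exists_le_zpowers_sup (hcyc i hi)
  refine isCyclic_map_mk'_of_le (f x) ((map_mono hx).trans ?_)
  rw [Subgroup.map_sup, MonoidHom.map_zpowers]

theorem of_subsingleton [Subsingleton G] : IsSupersoluble G :=
  ⟨0, fun _ => ⊥, fun _ => inferInstance, rfl, Subsingleton.elim _ _, fun _ _ _ => le_rfl, by simp⟩

theorem of_quotient_zpowers (v : G) [(zpowers v).Normal] (h : IsSupersoluble (G ⧸ zpowers v)) :
    IsSupersoluble G := by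
  obtain ⟨n, H, hN, h0, hn, hmono, hcyc⟩ := h
  -- The lifted series is shifted by one to make room for the factor `⟨v⟩ / 1`.
  let K : ℕ → Subgroup G := fun i => Nat.casesOn i ⊥ fun i => (H i).comap (QuotientGroup.mk' _)
  have hK : ∀ i, (K i).Normal := fun i => by
    cases i with
    | zero => exact inferInstanceAs (⊥ : Subgroup G).Normal
    | succ i => exact (hN i).comap _
  refine ⟨n + 1, K, hK, rfl, by simp [K, hn], monotone_nat_of_le_succ fun i => ?_, fun i hi => ?_⟩
  · cases i with
    | zero => exact bot_le
    | succ i => exact comap_mono (hmono i.le_succ)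
  · cases i with
    | zero =>
      refine @isCyclic_map_mk'_of_le G _ (K 0) (K 1) (hK 0) v ?_
      simp [K, h0]
    | succ i =>
      obtain ⟨y, hy⟩ := exists_le_zpowers_sup (hcyc i (by omega))
      obtain ⟨x, rfl⟩ := QuotientGroup.mk'_surjective _ y
      refine @isCyclic_map_mk'_of_le G _ (K (i + 1)) (K (i + 2)) (hK (i + 1)) x ?_
      refine (comap_mono hy).trans ?_
      rw [← MonoidHom.map_zpowers, ← comap_sup_eq _ _ _ (QuotientGroup.mk'_surjective _),
        comap_map_eq, QuotientGroup.ker_mk', sup_assoc]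
      exact sup_le_sup_left (sup_le (QuotientGroup.le_comap_mk' _ _) le_rfl) _

/-- `G'` centralizes every cyclic factor, so the series descends centrally for `G'`. -/
theorem commutator_isNilpotent (hG : IsSupersoluble G) : Group.IsNilpotent (commutator G) := by
  obtain ⟨n, H, hN, h0, hn, hmono, hcyc⟩ := hG
  have hstep : ∀ i < n, ⁅H (i + 1), commutator G⁆ ≤ H i := by
    intro i hi
    have := (hN (i + 1)).map _ (QuotientGroup.mk'_surjective (H i))
    have h1 := commutator_le_centralizer_of_isCyclic _ (hcyc i hi)
    rw [← commutator_eq_bot_iff_le_centralizer] at h1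
    rw [← QuotientGroup.ker_mk' (H i), ← Subgroup.map_eq_bot_iff, map_commutator, eq_bot_iff, ← h1,
      commutator_comm]
    exact commutator_mono (map_commutator_eq _ (QuotientGroup.mk' (H i)) ▸
      commutator_mono le_top le_top) le_rfl
  rw [isNilpotent_iff_lowerCentralSeries]
  have : ∀ k ≤ n, (commutator G).lowerCentralSeries k ≤ H (n - k) := by
    intro k
    induction k with
    | zero => intro _; simp [hn]
    | succ k ih =>
      intro hk
      rw [Subgroup.lowerCentralSeries_succ]
      have h2 := hstep (n - (k + 1)) (by omega)
      rw [show n - (k + 1) + 1 = n - k by omega] at h2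
      exact (commutator_mono (ih (by omega)) le_rfl).trans h2
  refine ⟨n, le_bot_iff.mp ((this n le_rfl).trans ?_)⟩
  simp [h0]

/-- The first nontrivial `N ∩ H (k + 1)` meets `H k` trivially, so it embeds in a cyclic factor. -/
theorem exists_zpowers_normal (hG : IsSupersoluble G) (N : Subgroup G) [N.Normal] (hN : N ≠ ⊥) :
    ∃ v ∈ N, v ≠ 1 ∧ (zpowers v).Normal := by
  classical
  obtain ⟨n, H, hH, h0, hn, hmono, hcyc⟩ := hG
  have hex : ∃ k, N ⊓ H k ≠ ⊥ := ⟨n, by rwa [hn, inf_top_eq]⟩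
  have hk := Nat.find_spec hex
  have hkn : Nat.find hex ≤ n := Nat.find_min' hex (by rwa [hn, inf_top_eq])
  obtain ⟨k, hk'⟩ : ∃ k, Nat.find hex = k + 1 :=
    Nat.exists_eq_succ_of_ne_zero fun h => hk (by rw [h, h0, inf_bot_eq])
  have hbot : N ⊓ H k = ⊥ := not_not.mp (Nat.find_min hex (by omega))
  rw [hk'] at hk
  have := hcyc k (by omega)
  let f : (N ⊓ H (k + 1) : Subgroup G) →* (H (k + 1)).map (QuotientGroup.mk' (H k)) :=
    ((QuotientGroup.mk' (H k)).subgroupMap (H (k + 1))).comp (inclusion inf_le_right)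
  have hf : Function.Injective f := by
    rw [injective_iff_map_eq_one]
    intro x hx
    have h1 : QuotientGroup.mk' (H k) x = 1 := congrArg Subtype.val hx
    have h2 : (x : G) ∈ N ⊓ H k := ⟨x.2.1, (QuotientGroup.eq_one_iff _).mp h1⟩
    rw [hbot, mem_bot] at h2
    exact Subtype.ext h2
  have hc : IsCyclic (N ⊓ H (k + 1) : Subgroup G) := isCyclic_of_injective f hf
  obtain ⟨v, hv⟩ := (Subgroup.isCyclic_iff_exists_zpowers_eq_top _).mp hc
  refine ⟨v, (hv ▸ mem_zpowers v : v ∈ N ⊓ H (k + 1)).1, ?_, ?_⟩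
  · rintro rfl
    exact hk (by rw [← hv, zpowers_one_eq_bot])
  · rw [hv]; infer_instance

end IsSupersoluble

/-! ### Common eigenvectors for `A` and `B` -/

namespace Subgroup

variable {G : Type*} [Group G]

/-- A subnormal subgroup meeting a nontrivial normal subgroup `V` trivially centralizes a
nontrivial element of `V`. -/
theorem IsSubnormal.inf_centralizer_ne_bot {A V : Subgroup G} (hA : A.IsSubnormal) [V.Normal]
    (hV : V ≠ ⊥) (h : A ⊓ V = ⊥) : V ⊓ centralizer A ≠ ⊥ := by
  induction hA with
  | top => exact absurd (by rwa [top_inf_eq] at h) hV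
  | step H K hHK hK hN ih =>
    by_cases hKV : K ⊓ V = ⊥
    · exact ne_bot_of_le_ne_bot (ih hKV) (inf_le_inf_left _ (centralizer_le hHK))
    -- `[K ∩ V, H]` lies in both `H` and `V`, hence is trivial.
    · refine ne_bot_of_le_ne_bot hKV (le_inf inf_le_right ?_)
      rw [← commutator_eq_bot_iff_le_centralizer, eq_bot_iff, ← h]
      rw [normal_subgroupOf_iff_le_normalizer hHK] at hN
      exact le_inf (le_normalizer_iff_commutator_le_right.mp (inf_le_left.trans hN))
        ((commutator_mono inf_le_right le_rfl).trans (commutator_le_left _ _))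

/-- A supersoluble subnormal subgroup `A` normalizes a nontrivial cyclic subgroup of every
nontrivial normal subgroup. -/
theorem IsSubnormal.exists_conj_eq_zpow {A V : Subgroup G} (hA : A.IsSubnormal)
    (hAs : IsSupersoluble A) [V.Normal] (hV : V ≠ ⊥) :
    ∃ v ∈ V, v ≠ 1 ∧ ∀ a ∈ A, ∃ k : ℤ, a * v * a⁻¹ = v ^ k := by
  by_cases h : A ⊓ V = ⊥
  · obtain ⟨v, hv, hv1⟩ :=
      (bot_or_exists_ne_one _).resolve_left (hA.inf_centralizer_ne_bot hV h)
    refine ⟨v, hv.1, hv1, fun a ha => ⟨1, ?_⟩⟩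
    rw [zpow_one, mul_inv_eq_iff_eq_mul]
    exact mem_centralizer_iff.mp hv.2 a ha
  · have hne : V.subgroupOf A ≠ ⊥ := by rwa [Ne, subgroupOf_eq_bot, disjoint_iff, inf_comm]
    obtain ⟨v, hvV, hv1, hn⟩ := hAs.exists_zpowers_normal _ hne
    refine ⟨v, hvV, fun h1 => hv1 (Subtype.ext h1), fun a ha => ?_⟩
    obtain ⟨k, hk⟩ := mem_zpowers_iff.mp (hn.conj_mem v (mem_zpowers v) ⟨a, ha⟩)
    exact ⟨k, by simpa using (congrArg Subtype.val hk).symm⟩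

/-- In an abelian normal subgroup `V` centralized by the commutator subgroup, the elements on
which every `a ∈ A` acts by raising to the power `k a` form a normal subgroup. -/
theorem exists_normal_eigenspace (A V : Subgroup G) [hV : V.Normal]
    (hVG : V ≤ centralizer (_root_.commutator G))
    (hVV : V ≤ centralizer V) (k : G → ℤ) :
    ∃ W : Subgroup G, W.Normal ∧ ∀ w, w ∈ W ↔ w ∈ V ∧ ∀ a ∈ A, a * w * a⁻¹ = w ^ k a := by
  refine ⟨{
    carrier := {w | w ∈ V ∧ ∀ a ∈ A, a * w * a⁻¹ = w ^ k a}
    one_mem' := ⟨one_mem _, fun a _ => by simp⟩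
    mul_mem' := ?_
    inv_mem' := ?_ }, ⟨?_⟩, fun w => Iff.rfl⟩
  · rintro x y ⟨hx, hx'⟩ ⟨hy, hy'⟩
    refine ⟨mul_mem hx hy, fun a ha => ?_⟩
    have : Commute x y := mem_centralizer_iff.mp (hVV hy) x hx
    rw [this.mul_zpow, ← hx' a ha, ← hy' a ha]
    group
  · rintro x ⟨hx, hx'⟩
    refine ⟨inv_mem hx, fun a ha => ?_⟩
    rw [inv_zpow, ← hx' a ha]
    group
  · rintro w ⟨hw, hw'⟩ g
    refine ⟨hV.conj_mem w hw g, fun a ha => ?_⟩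
    have h1 : ⁅g⁻¹, a⁆ * w = w * ⁅g⁻¹, a⁆ := by
      refine mem_centralizer_iff.mp (hVG hw) _ ?_
      exact commutator_mem_commutator (mem_top _) (mem_top _)
    have h2 : Commute ⁅g⁻¹, a⁆ (a * w * a⁻¹) := by
      rw [hw' a ha]
      exact Commute.zpow_right h1 _
    calc a * (g * w * g⁻¹) * a⁻¹ = g * (⁅g⁻¹, a⁆ * (a * w * a⁻¹) * ⁅g⁻¹, a⁆⁻¹) * g⁻¹ := by
          rw [commutatorElement_def]; group
      _ = (g * w * g⁻¹) ^ k a := by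
          rw [h2.eq, mul_inv_cancel_right, hw' a ha, conj_zpow]

theorem zpowers_normal_of_sup_eq_top {A B : Subgroup G} (hAB : A ⊔ B = ⊤) {v : G}
    (hA : ∀ a ∈ A, ∃ k : ℤ, a * v * a⁻¹ = v ^ k) (hB : ∀ b ∈ B, ∃ k : ℤ, b * v * b⁻¹ = v ^ k) :
    (zpowers v).Normal := by
  have key : ∀ C : Subgroup G, (∀ a ∈ C, ∃ k : ℤ, a * v * a⁻¹ = v ^ k) →
      C ≤ normalizer (zpowers v : Set G) := by
    intro C hC
    rw [le_normalizer_iff_commutator_le_right, commutator_le]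
    rintro a ha x hx
    obtain ⟨m, rfl⟩ := mem_zpowers_iff.mp hx
    obtain ⟨k, hk⟩ := hC a ha
    rw [commutatorElement_def, ← conj_zpow, hk]
    exact mul_mem (zpow_mem (zpow_mem (mem_zpowers v) _) _) (inv_mem hx)
  rw [← normalizer_eq_top_iff, ← top_le_iff, ← hAB]
  exact sup_le (key A hA) (key B hB)

/-- Take the center of `G'`, or `G` itself if `G' = 1`. -/
theorem exists_abelian_normal [Nontrivial G] (h : Group.IsNilpotent (_root_.commutator G)) :
    ∃ V : Subgroup G, V.Normal ∧ V ≠ ⊥ ∧ V ≤ centralizer (_root_.commutator G) ∧ V ≤ centralizer V := by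
  by_cases hc : _root_.commutator G = ⊥
  · have := commutator_eq_bot_iff_le_centralizer.mp hc
    refine ⟨⊤, inferInstance, top_ne_bot, ?_, this⟩
    rw [hc]
    exact this.trans (centralizer_le (Set.subset_univ _))
  · refine ⟨_root_.commutator G ⊓ centralizer (_root_.commutator G), inferInstance,
      inf_centralizer_ne_bot h le_rfl hc, inf_le_right, ?_⟩
    exact inf_le_right.trans (centralizer_le inf_le_left)

end Subgroup

theorem IsSupersoluble.of_sup_eq_top {G : Type*} [Group G] [Finite G] (A B : Subgroup G)
    (hAB : A ⊔ B = ⊤) (hA : IsSupersoluble A) (hB : IsSupersoluble B) (hAG : A.IsSubnormal)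
    (hBG : B.IsSubnormal) (hG : Group.IsNilpotent (commutator G)) : IsSupersoluble G := by
  induction hn : Nat.card G using Nat.strong_induction_on generalizing G with
  | _ n ih =>
  rcases subsingleton_or_nontrivial G with h | h
  · exact of_subsingleton
  obtain ⟨V, hVn, hV, hVG, hVV⟩ := exists_abelian_normal hG
  obtain ⟨u, huV, hu1, hu⟩ := hAG.exists_conj_eq_zpow hA hV
  choose! k hk using hu
  obtain ⟨W, hWn, hW⟩ := exists_normal_eigenspace A V hVG hVV k
  have hW1 : W ≠ ⊥ := fun h => hu1 (by
    have : u ∈ W := (hW u).mpr ⟨huV, hk⟩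
    rwa [h, mem_bot] at this)
  -- Choosing `v` in `W` keeps it an eigenvector for `A`.
  obtain ⟨v, hvW, hv1, hv⟩ := hBG.exists_conj_eq_zpow hB hW1
  have hN : (zpowers v).Normal := zpowers_normal_of_sup_eq_top hAB
    (fun a ha => ⟨k a, ((hW v).mp hvW).2 a ha⟩) hv
  have hsurj := QuotientGroup.mk'_surjective (zpowers v)
  refine of_quotient_zpowers v (ih _ ?_ (A.map (QuotientGroup.mk' _)) (B.map (QuotientGroup.mk' _))
    ?_ (hA.of_surjective _ (MonoidHom.subgroupMap_surjective _ A))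
    (hB.of_surjective _ (MonoidHom.subgroupMap_surjective _ B)) (hAG.map hsurj) (hBG.map hsurj)
    ?_ rfl)
  · rw [← hn, card_eq_card_quotient_mul_card_subgroup (zpowers v)]
    exact lt_mul_of_one_lt_right Nat.card_pos
      ((one_lt_card_iff_ne_bot _).mpr (zpowers_ne_bot.mpr hv1))
  · rw [← Subgroup.map_sup, hAB, map_top_of_surjective _ hsurj]
  · have := isNilpotent_map (QuotientGroup.mk' (zpowers v)) hG
    rwa [_root_.commutator_def, map_commutator, map_top_of_surjective _ hsurj,
      ← _root_.commutator_def] at this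

/-! ### Reduction to nilpotent `G'` -/

theorem IsSupersoluble.commutator_le_fittingSubgroup {G : Type*} [Group G] [Finite G]
    {A : Subgroup G} (hA : IsSupersoluble A) (hAG : A.IsSubnormal) :
    ⁅A, A⁆ ≤ fittingSubgroup G := by
  refine hAG.le_fittingSubgroup (Subgroup.commutator_le_self A) (normalizer_commutator_ge_left A A) ?_
  rw [← Subgroup.map_subtype_commutator]
  exact isNilpotent_map _ hA.commutator_isNilpotent

theorem Subgroup.normal_sup_of_commutator_le {G : Type*} [Group G] {A B F : Subgroup G}
    [F.Normal] (hAB : A ⊔ B = ⊤) (h : ⁅A, B⁆ ≤ F) : (A ⊔ F).Normal := by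
  have hsurj := QuotientGroup.mk'_surjective F
  have : (A.map (QuotientGroup.mk' F)).Normal := by
    rw [← normalizer_eq_top_iff, ← top_le_iff, ← map_top_of_surjective _ hsurj, ← hAB,
      Subgroup.map_sup]
    refine sup_le le_normalizer (le_normalizer_iff_commutator_le_right.mpr ?_)
    rw [← map_commutator, commutator_comm]
    refine le_of_eq_of_le ((map_eq_bot_iff _).mpr ?_) bot_le
    rwa [QuotientGroup.ker_mk']
  have := this.comap (QuotientGroup.mk' F)
  rwa [comap_map_eq, QuotientGroup.ker_mk'] at this

theorem Subgroup.commutator_le_of_sup_eq_top {G : Type*} [Group G] {A B F : Subgroup G}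
    [F.Normal] (hAB : A ⊔ B = ⊤) (hA : ⁅A, A⁆ ≤ F) (hB : ⁅B, B⁆ ≤ F) (h : ⁅A, B⁆ ≤ F) :
    _root_.commutator G ≤ F := by
  have key : ∀ X Y : Subgroup G, ⁅X, Y⁆ ≤ F ↔
      X.map (QuotientGroup.mk' F) ≤ centralizer (Y.map (QuotientGroup.mk' F)) := fun X Y => by
    rw [← commutator_eq_bot_iff_le_centralizer, ← map_commutator, map_eq_bot_iff,
      QuotientGroup.ker_mk']
  have h' : ⁅B, A⁆ ≤ F := commutator_comm A B ▸ h
  have h1 : ∀ X : Subgroup G, ⁅X, A⁆ ≤ F → ⁅X, B⁆ ≤ F → ⁅X, ⊤⁆ ≤ F := fun X hXA hXB => by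
    rw [key] at *
    rw [le_centralizer_iff, ← hAB, Subgroup.map_sup]
    exact sup_le (le_centralizer_iff.mp hXA) (le_centralizer_iff.mp hXB)
  rw [_root_.commutator_def]
  refine h1 ⊤ ?_ ?_
  · exact commutator_comm A ⊤ ▸ h1 A hA h
  · exact commutator_comm B ⊤ ▸ h1 B h' hB

theorem theorem4p6 {G : Type*} [Group G] [Finite G] (A B : Subgroup G)
    (hAB : A ⊔ B = ⊤)
    (hA : IsSupersoluble A) (hB : IsSupersoluble B)
    (hAF : Subgroup.IsRelSubnormal (fittingSubgroup G) A)
    (hBF : Subgroup.IsRelSubnormal (fittingSubgroup G) B)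
    (hnil : Group.IsNilpotent (⁅A, B⁆ : Subgroup G)) :
    IsSupersoluble G := by
  have hF := fittingSubgroup_normal G
  have hn : (⁅A, B⁆ : Subgroup G).Normal := by
    rw [← normalizer_eq_top_iff, ← top_le_iff, ← hAB]
    exact sup_le (normalizer_commutator_ge_left A B) (normalizer_commutator_ge_right A B)
  have hABF : ⁅A, B⁆ ≤ fittingSubgroup G := le_sSup ⟨hn, hnil⟩
  have hAG : A.IsSubnormal := IsSubnormal.trans le_sup_left hAF
    (normal_sup_of_commutator_le hAB hABF).isSubnormal
  have hBG : B.IsSubnormal := IsSubnormal.trans le_sup_left hBF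
    (normal_sup_of_commutator_le (sup_comm A B ▸ hAB) (commutator_comm A B ▸ hABF)).isSubnormal
  exact IsSupersoluble.of_sup_eq_top A B hAB hA hB hAG hBG
    (isNilpotent_of_le (fittingSubgroup_isNilpotent G)
      (commutator_le_of_sup_eq_top hAB (hA.commutator_le_fittingSubgroup hAG)
        (hB.commutator_le_fittingSubgroup hBG) hABF))
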